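/- Let $2^{<\mathbb N}$ be the set of finite $0$-$1$ sequences, ordered by end-extension, and let $\mathcal A$ be the family of all finite antichains of $2^{<\mathbb N}$. For $x\in\mathbb R^{2^{<\mathbb N}}$ put $\|x\|_{\mathcal A}=\sup\{\sum_{t\in F}|x(t)|:F\in\mathcal A\}\in[0,\infty]$, and let $X_{\mathcal A}$ be the space of all $x\in\mathbb R^{2^{<\mathbb N}}$ such that $\inf\{\|x\cdot\chi_{2^{<\mathbb N}\setminus E}\|_{\mathcal A}:E\subseteq 2^{<\mathbb N}\text{ finite}\}=0$, normed by $\|\cdot\|_{\mathcal A}$, with unit vectors $e_t$ ($t\in 2^{<\mathbb N}$). For $H\subseteq 2^{<\mathbb N}$ let $X_{\mathcal A\upharpoonright H}$ be the closed linear span of $\{e_t:t\in H\}$ in $X_{\mathcal A}$, and let \[\mathcal H(\mathcal A,\neg c_0)=\{H\subseteq 2^{<\mathbb N}: X_{\mathcal A\upharpoonright H}\text{ contains no subspace isomorphic to }c_0\}.\] Then \[\mathcal H(\mathcal A,\neg c_0)=\{H\subseteq 2^{<\mathbb N}: H\text{ contains no infinite chain}\}.\] Moreover, this family is an ideal (it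 contains all finite sets and is closed under subsets and finite unions), and it is $\mathbf\Pi^1_1$-complete in $\mathcal P(2^{<\mathbb N})\simeq 2^{(2^{<\mathbb N})}$ with the product topology: it is coanalytic, and for every zero-dimensional Polish space $Y$ and every coanalytic $B\subseteq Y$ there is a continuous $f:Y\to\mathcal P(2^{<\mathbb N})$ with $f^{-1}[\mathcal H(\mathcal A,\neg c_0)]=B$. -/

import Mathlib

open scoped ENNReal ZeroAtInfty

noncomputable section

namespace CombinatorialSpace

section General

variable {Ω : Type*}

/-- A family of finite subsets of `Ω` covers `Ω`. -/
class IsCover (𝓕 : Set (Finset Ω)) : Prop where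
  exists_mem : ∀ k : Ω, ∃ F ∈ 𝓕, k ∈ F

/-- The extended norm `‖x‖_𝓕 = sup {∑_{k ∈ F} |x k| : F ∈ 𝓕}` on `ℝ^Ω`. -/
def extNorm (𝓕 : Set (Finset Ω)) (x : Ω → ℝ) : ℝ≥0∞ :=
  ⨆ F ∈ 𝓕, ∑ k ∈ F, ENNReal.ofReal |x k|

theorem extNorm_zero (𝓕 : Set (Finset Ω)) : extNorm 𝓕 0 = 0 := by
  simp [extNorm]

theorem extNorm_add_le (𝓕 : Set (Finset Ω)) (x y : Ω → ℝ) :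
    extNorm 𝓕 (x + y) ≤ extNorm 𝓕 x + extNorm 𝓕 y := by
  refine iSup₂_le fun F hF => ?_
  calc ∑ k ∈ F, ENNReal.ofReal |(x + y) k|
      ≤ ∑ k ∈ F, (ENNReal.ofReal |x k| + ENNReal.ofReal |y k|) := by
        refine Finset.sum_le_sum fun k _ => ?_
        rw [← ENNReal.ofReal_add (abs_nonneg _) (abs_nonneg _)]
        exact ENNReal.ofReal_le_ofReal (abs_add_le _ _)
    _ = ∑ k ∈ F, ENNReal.ofReal |x k| + ∑ k ∈ F, ENNReal.ofReal |y k| :=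
        Finset.sum_add_distrib
    _ ≤ extNorm 𝓕 x + extNorm 𝓕 y :=
        add_le_add (le_iSup₂_of_le F hF le_rfl) (le_iSup₂_of_le F hF le_rfl)

theorem extNorm_smul (𝓕 : Set (Finset Ω)) (c : ℝ) (x : Ω → ℝ) :
    extNorm 𝓕 (c • x) = ENNReal.ofReal |c| * extNorm 𝓕 x := by
  simp only [extNorm, ENNReal.mul_iSup, Finset.mul_sum, Pi.smul_apply, smul_eq_mul, abs_mul,
    ENNReal.ofReal_mul (abs_nonneg c)]

theorem extNorm_mono (𝓕 : Set (Finset Ω)) {x y : Ω → ℝ} (h : ∀ k, |x k| ≤ |y k|) :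
    extNorm 𝓕 x ≤ extNorm 𝓕 y :=
  iSup₂_mono fun _ _ => Finset.sum_le_sum fun k _ => ENNReal.ofReal_le_ofReal (h k)

theorem extNorm_indicator_mono (𝓕 : Set (Finset Ω)) {A B : Set Ω} (h : A ⊆ B) (x : Ω → ℝ) :
    extNorm 𝓕 (A.indicator x) ≤ extNorm 𝓕 (B.indicator x) := by
  refine extNorm_mono 𝓕 fun k => ?_
  by_cases hA : k ∈ A
  · simp [hA, h hA]
  · simp [hA]

theorem extNorm_indicator_finset_lt_top (𝓕 : Set (Finset Ω)) (E : Finset Ω) (x : Ω → ℝ) :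
    extNorm 𝓕 ((E : Set Ω).indicator x) < ⊤ := by
  classical
  refine lt_of_le_of_lt (b := ∑ k ∈ E, ENNReal.ofReal |x k|) (iSup₂_le fun F _ => ?_)
    (ENNReal.sum_lt_top.2 fun _ _ => ENNReal.ofReal_lt_top)
  calc ∑ k ∈ F, ENNReal.ofReal |(E : Set Ω).indicator x k|
      = ∑ k ∈ F, if k ∈ E then ENNReal.ofReal |x k| else 0 := by
        refine Finset.sum_congr rfl fun k _ => ?_
        by_cases hk : k ∈ E <;> simp [hk]
    _ = ∑ k ∈ F.filter (· ∈ E), ENNReal.ofReal |x k| := (Finset.sum_filter _ _).symm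
    _ ≤ ∑ k ∈ E, ENNReal.ofReal |x k| :=
        Finset.sum_le_sum_of_subset fun k hk => (Finset.mem_filter.1 hk).2

/-- The vectors `x ∈ ℝ^Ω` with `inf {‖P_{Ω ∖ E} x‖_𝓕 : E ⊆ Ω finite} = 0`,
where `P_A x = A.indicator x`. -/
def exh (𝓕 : Set (Finset Ω)) : Submodule ℝ (Ω → ℝ) where
  carrier := {x | ⨅ E : Finset Ω, extNorm 𝓕 (((E : Set Ω)ᶜ).indicator x) = 0}
  zero_mem' := by
    simp only [Set.mem_ofPred_eq, Set.indicator_zero']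
    simp [extNorm_zero]
  add_mem' := by
    classical
    intro x y hx hy
    simp only [Set.mem_ofPred_eq] at hx hy ⊢
    refine le_antisymm ?_ (zero_le)
    refine ENNReal.le_of_forall_pos_le_add fun ε hε _ => ?_
    have hε2 : (0 : ℝ≥0∞) < (ε : ℝ≥0∞) / 2 :=
      ENNReal.div_pos (by exact_mod_cast hε.ne') (by simp)
    obtain ⟨E₁, h₁⟩ := iInf_lt_iff.1 (hx.trans_lt hε2)
    obtain ⟨E₂, h₂⟩ := iInf_lt_iff.1 (hy.trans_lt hε2)
    refine (iInf_le _ (E₁ ∪ E₂)).trans ?_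
    rw [Set.indicator_add', zero_add]
    refine (extNorm_add_le _ _ _).trans ?_
    rw [← ENNReal.add_halves (ε : ℝ≥0∞)]
    refine add_le_add ((extNorm_indicator_mono 𝓕 ?_ x).trans h₁.le)
      ((extNorm_indicator_mono 𝓕 ?_ y).trans h₂.le)
    · exact Set.compl_subset_compl.2 (by simp)
    · exact Set.compl_subset_compl.2 (by simp)
  smul_mem' := by
    intro c x hx
    simp only [Set.mem_ofPred_eq] at hx ⊢
    have h : ∀ E : Finset Ω, extNorm 𝓕 (((E : Set Ω)ᶜ).indicator (c • x)) =
        ENNReal.ofReal |c| * extNorm 𝓕 (((E : Set Ω)ᶜ).indicator x) := by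
      intro E
      rw [← extNorm_smul]
      congr 1
      ext k
      by_cases hk : k ∈ ((E : Set Ω)ᶜ) <;> simp [Set.indicator, hk]
    simp only [h]
    rw [← ENNReal.mul_iInf (fun h => absurd h ENNReal.ofReal_ne_top), hx, mul_zero]

theorem extNorm_lt_top_of_mem_exh {𝓕 : Set (Finset Ω)} {x : Ω → ℝ} (hx : x ∈ exh 𝓕) :
    extNorm 𝓕 x < ⊤ := by
  have hx' : ⨅ E : Finset Ω, extNorm 𝓕 (((E : Set Ω)ᶜ).indicator x) = 0 := hx
  obtain ⟨E, hE⟩ := iInf_lt_iff.1 (hx'.trans_lt ENNReal.zero_lt_top)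
  have h := extNorm_add_le 𝓕 ((E : Set Ω).indicator x) (((E : Set Ω)ᶜ).indicator x)
  rw [Set.indicator_self_add_compl] at h
  exact h.trans_lt (ENNReal.add_lt_top.2 ⟨extNorm_indicator_finset_lt_top 𝓕 E x, hE⟩)

/-- The combinatorial space `X_𝓕`. It is a type synonym of `exh 𝓕`, so that it carries the topology
of `‖·‖_𝓕` and not the topology of pointwise convergence. -/
def Space (𝓕 : Set (Finset Ω)) : Type _ := exh 𝓕

instance (𝓕 : Set (Finset Ω)) : AddCommGroup (Space 𝓕) := inferInstanceAs (AddCommGroup (exh 𝓕))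

instance (𝓕 : Set (Finset Ω)) : Module ℝ (Space 𝓕) := inferInstanceAs (Module ℝ (exh 𝓕))

/-- The sequence of coordinates of an element of `X_𝓕`. -/
def Space.coord {𝓕 : Set (Finset Ω)} : Space 𝓕 →ₗ[ℝ] (Ω → ℝ) := (exh 𝓕).subtype

instance (𝓕 : Set (Finset Ω)) [IsCover 𝓕] : NormedAddCommGroup (Space 𝓕) :=
  AddGroupNorm.toNormedAddCommGroup
    { toFun := fun x => (extNorm 𝓕 x.coord).toReal
      map_zero' := by simp [extNorm_zero]
      add_le' := fun x y => by
        have hx : extNorm 𝓕 x.coord < ⊤ := extNorm_lt_top_of_mem_exh x.2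
        have hy : extNorm 𝓕 y.coord < ⊤ := extNorm_lt_top_of_mem_exh y.2
        rw [← ENNReal.toReal_add hx.ne hy.ne, map_add]
        exact ENNReal.toReal_mono (ENNReal.add_ne_top.2 ⟨hx.ne, hy.ne⟩) (extNorm_add_le _ _ _)
      neg' := fun x => by
        simp [extNorm]
      eq_zero_of_map_eq_zero' := fun x h => by
        have hx : extNorm 𝓕 x.coord < ⊤ := extNorm_lt_top_of_mem_exh x.2
        have h0 : extNorm 𝓕 x.coord = 0 := by
          rcases (ENNReal.toReal_eq_zero_iff _).1 h with h | h
          · exact h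
          · exact absurd h hx.ne
        refine Subtype.ext (funext fun k => ?_)
        obtain ⟨F, hF, hk⟩ := IsCover.exists_mem (𝓕 := 𝓕) k
        simp only [extNorm, ENNReal.iSup_eq_zero, Finset.sum_eq_zero_iff] at h0
        have h1 := ENNReal.ofReal_eq_zero.1 (h0 F hF k hk)
        exact abs_nonpos_iff.1 h1 }

theorem Space.norm_def {𝓕 : Set (Finset Ω)} [IsCover 𝓕] (x : Space 𝓕) :
    ‖x‖ = (extNorm 𝓕 x.coord).toReal := rfl

instance (𝓕 : Set (Finset Ω)) [IsCover 𝓕] : NormedSpace ℝ (Space 𝓕) where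
  norm_smul_le c x := by
    rw [Space.norm_def, Space.norm_def, map_smul, extNorm_smul, ENNReal.toReal_mul,
      ENNReal.toReal_ofReal (abs_nonneg c), Real.norm_eq_abs]

/-- The canonical unit vector `e_k` of `X_𝓕`. -/
def basisVec [DecidableEq Ω] (𝓕 : Set (Finset Ω)) (k : Ω) : Space 𝓕 :=
  ⟨Pi.single k 1, by
    refine le_antisymm ((iInf_le _ {k}).trans ?_) (zero_le)
    have h : ((({k} : Finset Ω) : Set Ω)ᶜ).indicator (Pi.single k (1 : ℝ)) = 0 := by
      ext j
      by_cases hj : j = k <;> simp [hj]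
    rw [h, extNorm_zero]⟩

/-- `X_{𝓕 ↾ H}`: the closed linear span of `{e_k : k ∈ H}` in `X_𝓕`. -/
def spaceOn [DecidableEq Ω] (𝓕 : Set (Finset Ω)) [IsCover 𝓕] (H : Set Ω) :
    Submodule ℝ (Space 𝓕) :=
  (Submodule.span ℝ (basisVec 𝓕 '' H)).topologicalClosure

/-- `X` contains a copy of `c₀`: there is a bounded linear map `c₀ → X` that is bounded below, that
is, an isomorphism of `c₀` onto a closed subspace of `X`. -/
def ContainsC0 (X : Type*) [NormedAddCommGroup X] [NormedSpace ℝ X] : Prop :=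
  ∃ T : C₀(ℕ, ℝ) →L[ℝ] X, ∃ c : ℝ, 0 < c ∧ ∀ a : C₀(ℕ, ℝ), c * ‖a‖ ≤ ‖T a‖

/-- `𝓗(𝓕, ¬c₀)`. -/
def idealNoC0 [DecidableEq Ω] (𝓕 : Set (Finset Ω)) [IsCover 𝓕] : Set (Set Ω) :=
  {H | ¬ ContainsC0 (spaceOn 𝓕 H)}

/-- Ideals of subsets of `Ω`: families that contain all singletons (so cover `Ω`), contain `∅`, and
are closed under subsets and finite unions. -/
def IsIdealOfSets (𝓗 : Set (Set Ω)) : Prop :=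
  ∅ ∈ 𝓗 ∧ (∀ k, {k} ∈ 𝓗) ∧ (∀ A B, A ⊆ B → B ∈ 𝓗 → A ∈ 𝓗) ∧ ∀ A ∈ 𝓗, ∀ B ∈ 𝓗, A ∪ B ∈ 𝓗

/-- A family of subsets of `Ω` viewed, through characteristic functions, as a subset of the product
space `2^Ω`. -/
def charFunctions (𝓗 : Set (Set Ω)) : Set (Ω → Bool) :=
  {χ | {k | χ k = true} ∈ 𝓗}

end General

/-- Coanalytic, that is, boldface `Π¹₁`, sets. -/
def IsCoanalytic {X : Type*} [TopologicalSpace X] (A : Set X) : Prop :=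
  MeasureTheory.AnalyticSet Aᶜ

universe u v

/-- `A` is boldface `Π¹₁`-complete: it is `Π¹₁`, and every `Π¹₁` subset of a zero-dimensional Polish
space is a continuous preimage of `A`. -/
def IsPi11Complete {X : Type v} [TopologicalSpace X] (A : Set X) : Prop :=
  IsCoanalytic A ∧
    ∀ (Y : Type u) [TopologicalSpace Y] [PolishSpace Y],
      TopologicalSpace.IsTopologicalBasis {U : Set Y | IsClopen U} →
      ∀ B : Set Y, IsCoanalytic B → ∃ f : Y → X, Continuous f ∧ f ⁻¹' A = B

/-- The binary tree `2^{<ℕ}` of finite `0`-`1` sequences, ordered by end-extension `<+:`. -/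
abbrev BinTree : Type := List Bool

/-- The family of all finite antichains of the binary tree. -/
def antichains : Set (Finset BinTree) :=
  {F | IsAntichain (· <+: ·) (F : Set BinTree)}

instance : IsCover antichains where
  exists_mem k := ⟨{k}, by simp [antichains], by simp⟩

end CombinatorialSpace

end

open scoped ENNReal ZeroAtInfty

noncomputable section

namespace CombinatorialSpace

/-! ### Coordinates, the norm of `Space 𝓕` and membership in `spaceOn`. -/

section Norm

variable {Ω : Type*} {𝓕 : Set (Finset Ω)}

/-! An antichain meets a chain in at most one point, so along an infinite chain the norm is the
supremum norm and `chainEmbedding` is an isometric copy of `c₀`.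

Conversely, let `H` have no infinite chain and let `T` embed `c₀` in `spaceOn antichains H`. The
images of the unit vectors have norms bounded below and coordinates tending to `0`, so a gliding
hump yields disjoint finite antichains `A k` in `H`, each carrying a fixed amount of mass of one
image. `exists_antichain_of_weights` picks any number `J` of them and retains half of that amount on
each, so that the union of the retained parts is an antichain. With the signs from `exists_signs`, a
combination of the images has norm at least a fixed multiple of `J`, yet at most `‖T‖`.

The selection uses a finitely additive `ν`, the ultrafilter limit of the mass distributions on the
`A k`. If the extensions of infinitely many `A n` had measure at least `ε`, a Borel–Cantelli
argument and compactness of the Cantor space would give a branch meeting infinitely many `A n`.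
Hence almost all `A n` have `ν`-small extension sets, and suitable later antichains put little mass
above those already chosen.

For the complexity, the complement is the projection of a Borel set. Hardness turns "`y` is a value
of `g`" into "a tree of approximations has an infinite branch", and `unaryCode` moves that tree into
the binary one. -/

theorem sum_ofReal_abs (F : Finset Ω) (x : Ω → ℝ) :
    ∑ k ∈ F, ENNReal.ofReal |x k| = ENNReal.ofReal (∑ k ∈ F, |x k|) :=
  (ENNReal.ofReal_sum_of_nonneg fun _ _ => abs_nonneg _).symm

theorem sum_abs_coord_le_norm [IsCover 𝓕] (x : Space 𝓕) {F : Finset Ω} (hF : F ∈ 𝓕) :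
    ∑ k ∈ F, |x.coord k| ≤ ‖x‖ := by
  have hx : extNorm 𝓕 x.coord < ⊤ := extNorm_lt_top_of_mem_exh x.2
  rw [Space.norm_def, ← ENNReal.ofReal_le_iff_le_toReal hx.ne, ← sum_ofReal_abs]
  exact le_iSup₂_of_le F hF le_rfl

theorem abs_coord_le_norm [IsCover 𝓕] (x : Space 𝓕) (k : Ω) : |x.coord k| ≤ ‖x‖ := by
  obtain ⟨F, hF, hk⟩ := IsCover.exists_mem (𝓕 := 𝓕) k
  exact (Finset.single_le_sum (f := fun k => |x.coord k|) (fun _ _ => abs_nonneg _) hk).trans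
    (sum_abs_coord_le_norm x hF)

theorem exists_lt_sum_abs_coord [IsCover 𝓕] {x : Space 𝓕} {r : ℝ} (hr : 0 ≤ r) (h : r < ‖x‖) :
    ∃ F ∈ 𝓕, r < ∑ k ∈ F, |x.coord k| := by
  have hx : extNorm 𝓕 x.coord < ⊤ := extNorm_lt_top_of_mem_exh x.2
  rw [Space.norm_def, ← ENNReal.ofReal_lt_iff_lt_toReal hr hx.ne] at h
  simp only [extNorm, lt_iSup_iff, sum_ofReal_abs] at h
  obtain ⟨F, hF, h⟩ := h
  exact ⟨F, hF, (ENNReal.ofReal_lt_ofReal_iff_of_nonneg hr).1 h⟩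

/-- The coordinate functionals of `X_𝓕`. -/
def coordCLM [IsCover 𝓕] (k : Ω) : Space 𝓕 →L[ℝ] ℝ :=
  ((LinearMap.proj k).comp Space.coord).mkContinuous 1 fun x => by
    simpa using abs_coord_le_norm x k

theorem coordCLM_apply [IsCover 𝓕] (k : Ω) (x : Space 𝓕) : coordCLM k x = x.coord k := rfl

variable [DecidableEq Ω]

theorem coord_basisVec (k : Ω) : (basisVec 𝓕 k).coord = Pi.single k 1 := rfl

theorem coord_eq_zero_of_mem_spaceOn [IsCover 𝓕] {H : Set Ω} {x : Space 𝓕}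
    (hx : x ∈ spaceOn 𝓕 H) {k : Ω} (hk : k ∉ H) : x.coord k = 0 := by
  have hle : spaceOn 𝓕 H ≤ LinearMap.ker (coordCLM (𝓕 := 𝓕) k).toLinearMap := by
    refine Submodule.topologicalClosure_minimal _ (Submodule.span_le.2 ?_)
      (ContinuousLinearMap.isClosed_ker _)
    rintro _ ⟨j, hj, rfl⟩
    have : k ≠ j := fun h => hk (h ▸ hj)
    simp [coordCLM_apply, coord_basisVec, this]
  exact hle hx

/-- The condition defining `exh` says precisely that the finite truncations of `x` approximate it in
norm; they lie in the span. -/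
theorem mem_spaceOn_of_support_subset [IsCover 𝓕] {H : Set Ω} {x : Space 𝓕}
    (hx : ∀ k, k ∉ H → x.coord k = 0) : x ∈ spaceOn 𝓕 H := by
  refine Metric.mem_closure_iff.2 fun ε hε => ?_
  have hx' : ⨅ E : Finset Ω, extNorm 𝓕 (((E : Set Ω)ᶜ).indicator x.coord) = 0 := x.2
  obtain ⟨E, hE⟩ := iInf_lt_iff.1 (hx'.trans_lt (ENNReal.ofReal_pos.2 hε))
  refine ⟨∑ k ∈ E, x.coord k • basisVec 𝓕 k, ?_, ?_⟩
  · refine Submodule.sum_mem _ fun k _ => ?_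
    by_cases hk : k ∈ H
    · exact Submodule.smul_mem _ _ (Submodule.subset_span ⟨k, hk, rfl⟩)
    · simp [hx k hk]
  · have h : (x - ∑ k ∈ E, x.coord k • basisVec 𝓕 k).coord =
        ((E : Set Ω)ᶜ).indicator x.coord := by
      ext j
      by_cases hj : j ∈ E <;>
        simp [coord_basisVec, Pi.single_apply, hj]
    rw [dist_eq_norm, Space.norm_def, h]
    exact (ENNReal.lt_ofReal_iff_toReal_lt (hE.trans_le le_top).ne).1 hE

end Norm

/-! ### An infinite chain gives an isometric copy of `c₀`. -/

section Chain

open ZeroAtInftyContinuousMap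

theorem norm_le_of_forall_abs_le {a : C₀(ℕ, ℝ)} {r : ℝ} (hr : 0 ≤ r) (h : ∀ n, |a n| ≤ r) :
    ‖a‖ ≤ r := by
  rw [← norm_toBCF_eq_norm]
  exact (BoundedContinuousFunction.norm_le hr).2 h

theorem abs_apply_le_norm (a : C₀(ℕ, ℝ)) (n : ℕ) : |a n| ≤ ‖a‖ := by
  rw [← norm_toBCF_eq_norm]
  exact a.toBCF.norm_coe_le_norm n

theorem finite_le_abs (a : C₀(ℕ, ℝ)) {ε : ℝ} (hε : 0 < ε) : {n | ε ≤ |a n|}.Finite := by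
  have h := a.zero_at_infty'
  rw [Filter.cocompact_eq_cofinite] at h
  have h2 := h.eventually (Metric.ball_mem_nhds 0 hε)
  refine h2.subset fun n hn => ?_
  simpa using hn

theorem extNorm_antichains_le_of_chain {C : Set BinTree} (hC : IsChain (· <+: ·) C)
    {x : BinTree → ℝ} (hx : ∀ t, t ∉ C → x t = 0) {r : ℝ} (h : ∀ t, |x t| ≤ r) :
    extNorm antichains x ≤ ENNReal.ofReal r := by
  refine iSup₂_le fun F hF => ?_
  by_cases hFC : ∃ t ∈ F, t ∈ C
  · obtain ⟨t, htF, htC⟩ := hFC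
    rw [Finset.sum_eq_single_of_mem t htF]
    · exact ENNReal.ofReal_le_ofReal (h t)
    · intro s hs hst
      by_cases hsC : s ∈ C
      · rcases hC hsC htC hst with h | h
        · exact absurd h (hF hs htF hst)
        · exact absurd h (hF htF hs hst.symm)
      · simp [hx s hsC]
  · push Not at hFC
    rw [Finset.sum_eq_zero fun t ht => by simp [hx t (hFC t ht)]]
    exact zero_le

/-- Removing the finitely many nodes where `|a n| ≥ ε` leaves a vector on a chain with entries at
most `ε`, hence of norm at most `ε`. -/
theorem extend_mem_exh {t : ℕ → BinTree} (ht : Function.Injective t)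
    (hC : IsChain (· <+: ·) (Set.range t)) (a : C₀(ℕ, ℝ)) :
    Function.extend t a 0 ∈ exh antichains := by
  classical
  change ⨅ E : Finset BinTree, extNorm antichains
    (((E : Set BinTree)ᶜ).indicator (Function.extend t a 0)) = 0
  refine le_antisymm (ENNReal.le_of_forall_pos_le_add fun ε hε _ => ?_) zero_le
  have hε' : (0 : ℝ) < ε := hε
  refine (iInf_le _ ((finite_le_abs a hε').toFinset.image t)).trans ?_
  rw [zero_add, ← ENNReal.ofReal_coe_nnreal]
  refine extNorm_antichains_le_of_chain hC (fun s hs => ?_) fun s => ?_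
  · have : Function.extend t a 0 s = 0 := by
      rw [Function.extend_apply' _ _ _ fun ⟨n, hn⟩ => hs ⟨n, hn⟩]; rfl
    simp [Set.indicator_apply, this]
  · by_cases hs : ∃ n, t n = s
    · obtain ⟨n, rfl⟩ := hs
      by_cases hn : (ε : ℝ) ≤ |a n|
      · have : t n ∈ ((finite_le_abs a hε').toFinset.image t : Finset BinTree) :=
          Finset.mem_image_of_mem _ (by simpa using hn)
        rw [Set.indicator_of_notMem (by simpa using this)]
        simp
      · refine le_trans ?_ (not_le.1 hn).le
        rw [Set.indicator_apply, ht.extend_apply]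
        split_ifs <;> simp
    · have : Function.extend t a 0 s = 0 := by
        rw [Function.extend_apply' _ _ _ hs]; rfl
      simp [Set.indicator_apply, this]

/-- The canonical copy of `c₀` in `X_𝓐` spanned by the unit vectors along an infinite chain. -/
def chainEmbedding {t : ℕ → BinTree} (ht : Function.Injective t)
    (hC : IsChain (· <+: ·) (Set.range t)) : C₀(ℕ, ℝ) →ₗ[ℝ] Space antichains where
  toFun a := ⟨Function.extend t a 0, extend_mem_exh ht hC a⟩
  map_add' a b := by
    refine Subtype.ext (funext fun s => ?_)
    change Function.extend t (a + b : C₀(ℕ, ℝ)) 0 s = Function.extend t a 0 s + Function.extend t b 0 s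
    by_cases hs : ∃ n, t n = s
    · obtain ⟨n, rfl⟩ := hs
      simp [ht.extend_apply]
    · simp [Function.extend_apply' _ _ _ hs]
  map_smul' c a := by
    refine Subtype.ext (funext fun s => ?_)
    change Function.extend t (c • a : C₀(ℕ, ℝ)) 0 s = c * Function.extend t a 0 s
    by_cases hs : ∃ n, t n = s
    · obtain ⟨n, rfl⟩ := hs
      simp [ht.extend_apply]
    · simp [Function.extend_apply' _ _ _ hs]

theorem coord_chainEmbedding {t : ℕ → BinTree} (ht : Function.Injective t)
    (hC : IsChain (· <+: ·) (Set.range t)) (a : C₀(ℕ, ℝ)) :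
    (chainEmbedding ht hC a).coord = Function.extend t a 0 := rfl

theorem norm_chainEmbedding {t : ℕ → BinTree} (ht : Function.Injective t)
    (hC : IsChain (· <+: ·) (Set.range t)) (a : C₀(ℕ, ℝ)) :
    ‖chainEmbedding ht hC a‖ = ‖a‖ := by
  refine le_antisymm ?_ (norm_le_of_forall_abs_le (norm_nonneg _) fun n => ?_)
  · rw [Space.norm_def, coord_chainEmbedding]
    refine ENNReal.toReal_le_of_le_ofReal (norm_nonneg _)
      (extNorm_antichains_le_of_chain hC (fun s hs => ?_) fun s => ?_)
    · rw [Function.extend_apply' _ _ _ fun ⟨n, hn⟩ => hs ⟨n, hn⟩]; rfl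
    · by_cases hs : ∃ n, t n = s
      · obtain ⟨n, rfl⟩ := hs
        rw [ht.extend_apply]
        exact abs_apply_le_norm a n
      · simp [Function.extend_apply' _ _ _ hs]
  · have h := abs_coord_le_norm (chainEmbedding ht hC a) (t n)
    rwa [coord_chainEmbedding, ht.extend_apply] at h

theorem containsC0_of_infinite_chain {H C : Set BinTree} (hCH : C ⊆ H) (hinf : C.Infinite)
    (hC : IsChain (· <+: ·) C) : ContainsC0 (spaceOn antichains H) := by
  let t : ℕ → BinTree := fun n => hinf.natEmbedding C n
  have ht : Function.Injective t := fun m n h => (hinf.natEmbedding C).injective (Subtype.ext h)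
  have htC : Set.range t ⊆ C := by
    rintro _ ⟨n, rfl⟩
    exact (hinf.natEmbedding C n).2
  have hC' := hC.mono htC
  let T := (chainEmbedding ht hC').codRestrict (spaceOn antichains H) fun a =>
    mem_spaceOn_of_support_subset fun s hs => by
      rw [coord_chainEmbedding, Function.extend_apply' _ _ _ fun ⟨n, hn⟩ => hs (hCH (htC ⟨n, hn⟩))]
      rfl
  have hT : ∀ a, ‖T a‖ = ‖a‖ := norm_chainEmbedding ht hC'
  exact ⟨T.mkContinuous 1 fun a => by rw [hT, one_mul], 1, one_pos, fun a => by
    rw [one_mul, LinearMap.mkContinuous_apply, hT]⟩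

end Chain

end CombinatorialSpace

namespace CombinatorialSpace

/-! ### Sets without infinite chains form an ideal. -/

section Ideal

/-- The sets of finite `0`-`1` sequences that contain no infinite chain. -/
def noInfiniteChain : Set (Set BinTree) :=
  {H | ¬ ∃ C : Set BinTree, C ⊆ H ∧ C.Infinite ∧ IsChain (· <+: ·) C}

theorem mem_noInfiniteChain_of_finite {H : Set BinTree} (hH : H.Finite) :
    H ∈ noInfiniteChain := fun ⟨_, hCH, hC, _⟩ => hC (hH.subset hCH)

theorem isIdealOfSets_noInfiniteChain : IsIdealOfSets noInfiniteChain := by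
  refine ⟨mem_noInfiniteChain_of_finite Set.finite_empty,
    fun k => mem_noInfiniteChain_of_finite (Set.finite_singleton k), ?_, ?_⟩
  · rintro A B hAB hB ⟨C, hCA, hC⟩
    exact hB ⟨C, hCA.trans hAB, hC⟩
  · rintro A hA B hB ⟨C, hCAB, hinf, hC⟩
    rw [← Set.inter_eq_left.2 hCAB, Set.inter_union_distrib_left] at hinf
    rcases Set.infinite_union.1 hinf with h | h
    · exact hA ⟨C ∩ A, Set.inter_subset_right, h, hC.mono Set.inter_subset_left⟩
    · exact hB ⟨C ∩ B, Set.inter_subset_right, h, hC.mono Set.inter_subset_left⟩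

end Ideal

/-! ### The upper bound: coanalyticity. -/

section Coanalytic

open MeasureTheory

theorem isCoanalytic_noInfiniteChain : IsCoanalytic (charFunctions noInfiniteChain) := by
  -- The second coordinate codes an infinite chain inside the first. Infinitude is phrased as
  -- escaping every finite set `E`, so that all quantifiers are countable and `P` is Borel.
  let P : Set ((BinTree → Bool) × (BinTree → Bool)) :=
    {p | (∀ t, p.2 t = true → p.1 t = true) ∧ (∀ E : Finset BinTree, ∃ t, t ∉ E ∧ p.2 t = true) ∧
      ∀ s t, p.2 s = true → p.2 t = true → s <+: t ∨ t <+: s}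
  have h₁ : ∀ t, MeasurableSet {p : (BinTree → Bool) × (BinTree → Bool) | p.1 t = true} := fun t =>
    measurableSet_eq_fun ((measurable_pi_apply t).comp measurable_fst) measurable_const
  have h₂ : ∀ t, MeasurableSet {p : (BinTree → Bool) × (BinTree → Bool) | p.2 t = true} := fun t =>
    measurableSet_eq_fun ((measurable_pi_apply t).comp measurable_snd) measurable_const
  have hP : MeasurableSet P := by
    have hP' : P = (⋂ t, {p | p.2 t = true}ᶜ ∪ {p | p.1 t = true}) ∩
        ((⋂ E : Finset BinTree, ⋃ t, ⋃ _ : t ∉ E, {p | p.2 t = true}) ∩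
          ⋂ s, ⋂ t, ⋂ _ : ¬ (s <+: t ∨ t <+: s), {p | p.2 s = true}ᶜ ∪ {p | p.2 t = true}ᶜ) := by
      ext p
      simp only [P, Set.mem_inter_iff, Set.mem_iInter, Set.mem_iUnion, Set.mem_union,
        Set.mem_compl_iff, Set.mem_ofPred_eq, exists_prop]
      grind
    rw [hP']
    exact (MeasurableSet.iInter fun t => (h₂ t).compl.union (h₁ t)).inter
      ((MeasurableSet.iInter fun E => MeasurableSet.iUnion fun t => MeasurableSet.iUnion fun _ =>
        h₂ t).inter (MeasurableSet.iInter fun s => MeasurableSet.iInter fun t =>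
          MeasurableSet.iInter fun _ => (h₂ s).compl.union (h₂ t).compl))
  have hPc : (charFunctions noInfiniteChain)ᶜ = Prod.fst '' P := by
    ext χ
    simp only [charFunctions, noInfiniteChain, Set.mem_compl_iff, Set.mem_ofPred_eq, not_not,
      Set.mem_image, Prod.exists, exists_and_right, exists_eq_right, P]
    constructor
    · classical
      rintro ⟨C, hCH, hinf, hC⟩
      refine ⟨fun t => decide (t ∈ C), fun t ht => hCH (by simpa using ht), fun E => ?_,
        fun s t hs ht => hC.total (by simpa using hs) (by simpa using ht)⟩
      obtain ⟨t, ht, htE⟩ := hinf.exists_notMem_finset E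
      exact ⟨t, htE, by simpa using ht⟩
    · rintro ⟨c, h1, h2, h3⟩
      refine ⟨{t | c t = true}, fun t ht => h1 t ht, fun hfin => ?_,
        fun s hs t ht _ => h3 s t hs ht⟩
      obtain ⟨t, htE, ht⟩ := h2 hfin.toFinset
      exact htE (by simpa using ht)
  rw [IsCoanalytic, hPc]
  exact hP.analyticSet_image measurable_fst

end Coanalytic

/-! ### The lower bound: reducing an arbitrary coanalytic set. -/

section Hardness

/-- The monotone embedding of `ℕ^{<ℕ}` into `2^{<ℕ}` that sends `(n₀, …, n_k)` to
`0^{n₀} 1 ⋯ 0^{n_k} 1`. -/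
def unaryCode (s : List ℕ) : BinTree :=
  s.flatMap fun n => List.replicate n false ++ [true]

theorem replicate_append_prefix {m n : ℕ} {r r' : List Bool}
    (h : List.replicate m false ++ true :: r <+: List.replicate n false ++ true :: r') :
    m = n ∧ r <+: r' := by
  induction m generalizing n with
  | zero =>
    cases n with
    | zero => simpa using h
    | succ n => simp [List.replicate_succ, List.cons_prefix_cons] at h
  | succ m ih =>
    cases n with
    | zero => simp [List.replicate_succ, List.cons_prefix_cons] at h
    | succ n =>
      simp only [List.replicate_succ, List.cons_append, List.cons_prefix_cons, true_and] at h
      simpa using ih h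

theorem unaryCode_prefix_iff {s t : List ℕ} : unaryCode s <+: unaryCode t ↔ s <+: t := by
  refine ⟨fun h => ?_, ?_⟩
  · induction s generalizing t with
    | nil => exact List.nil_prefix
    | cons m s ih =>
      cases t with
      | nil => simp [unaryCode] at h
      | cons n t =>
        simp only [unaryCode, List.flatMap_cons, List.append_assoc, List.singleton_append] at h
        obtain ⟨rfl, hst⟩ := replicate_append_prefix h
        exact List.cons_prefix_cons.2 ⟨rfl, ih hst⟩
  · rintro ⟨r, rfl⟩
    simp [unaryCode]

theorem unaryCode_injective : Function.Injective unaryCode := fun s t h => by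
  have h₁ : s <+: t := unaryCode_prefix_iff.1 (by rw [h])
  have h₂ : t <+: s := unaryCode_prefix_iff.1 (by rw [h])
  exact h₁.eq_of_length (le_antisymm h₁.length_le h₂.length_le)

/-- The finite sequence `s` is an initial segment of the infinite sequence `x`. -/
def IsInitial {α : Type*} (s : List α) (x : ℕ → α) : Prop :=
  ∀ i (h : i < s.length), s[i] = x i

theorem IsInitial.prefix {α : Type*} {s t : List α} {x : ℕ → α} (hs : IsInitial s x)
    (ht : IsInitial t x) (h : s.length ≤ t.length) : s <+: t := by
  rw [List.prefix_iff_getElem]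
  exact ⟨h, fun i hi => (hs i hi).trans (ht i (hi.trans_le h)).symm⟩

theorem IsInitial.of_prefix {α : Type*} {s t : List α} {x : ℕ → α} (h : s <+: t)
    (ht : IsInitial t x) : IsInitial s x := fun i hi => by
  rw [h.getElem hi]
  exact ht i _

theorem isChain_isInitial {α : Type*} (x : ℕ → α) : IsChain (· <+: ·) {s | IsInitial s x} := by
  intro s hs t ht _
  exact (le_total s.length t.length).imp (hs.prefix ht) (ht.prefix hs)

theorem exists_length_ge_of_infinite_chain {α : Type*} {C : Set (List α)} (hinf : C.Infinite)
    (hC : IsChain (· <+: ·) C) (n : ℕ) : ∃ s ∈ C, n ≤ s.length := by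
  by_contra! h
  refine hinf (Set.Finite.of_finite_image (f := List.length)
    ((Set.finite_Iio n).subset (by rintro _ ⟨s, hs, rfl⟩; exact h s hs)) fun s hs t ht hst => ?_)
  rcases hC.total hs ht with h | h
  · exact h.eq_of_length hst
  · exact (h.eq_of_length hst.symm).symm

/-- A chain has members of every length, and they agree wherever they overlap; entry `i` of the
branch is read off a member of length at least `i + 1`. -/
theorem exists_isInitial_of_infinite_chain {α : Type*} {C : Set (List α)} (hinf : C.Infinite)
    (hC : IsChain (· <+: ·) C) : ∃ x : ℕ → α, ∀ s ∈ C, IsInitial s x := by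
  choose S hS hSl using exists_length_ge_of_infinite_chain hinf hC
  refine ⟨fun i => (S (i + 1))[i]'(hSl (i + 1)), fun s hs i hi => ?_⟩
  rcases hC.total hs (hS (i + 1)) with h | h
  · exact h.getElem hi
  · exact (h.getElem (hSl (i + 1))).symm

variable {Y : Type*}

/-- The tree of attempts to approximate `y` by values of `g`, with respect to a sequence `U` of
subsets of `Y`. -/
def approxTree (U : ℕ → Set Y) (g : (ℕ → ℕ) → Y) (y : Y) : Set (List ℕ) :=
  {s | ∃ z, IsInitial s z ∧ ∀ i < s.length, g z ∈ U i ↔ y ∈ U i}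

theorem exists_infinite_chain_approxTree (U : ℕ → Set Y) (g : (ℕ → ℕ) → Y) (x : ℕ → ℕ) :
    ∃ C ⊆ approxTree U g (g x), C.Infinite ∧ IsChain (· <+: ·) C := by
  refine ⟨{s | IsInitial s x}, fun s hs => ⟨x, hs, fun _ _ => Iff.rfl⟩, ?_, isChain_isInitial x⟩
  refine Set.infinite_of_injective_forall_mem (f := fun n => (List.range n).map x) (fun m n h => ?_)
    fun n i hi => by simp
  simpa using congrArg List.length h

variable [TopologicalSpace Y]

/-- Whether `s` is in the tree depends on `y` only through finitely many clopen conditions, whose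
truth values are locally constant. -/
theorem isClopen_mem_approxTree {U : ℕ → Set Y} (hU : ∀ i, IsClopen (U i)) (g : (ℕ → ℕ) → Y)
    (s : List ℕ) : IsClopen {y | s ∈ approxTree U g y} := by
  have hopen : ∀ Q : Set (Fin s.length → Prop), IsOpen {y | (fun i : Fin s.length => y ∈ U i) ∈ Q} := by
    intro Q
    refine isOpen_iff_mem_nhds.2 fun y hy => ?_
    have h : ∀ i : Fin s.length, ∀ᶠ y' in nhds y, y' ∈ U i ↔ y ∈ U i := fun i => by
      by_cases hi : y ∈ U i
      · filter_upwards [(hU i).isOpen.mem_nhds hi] with y' hy'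
        simp [hi, hy']
      · filter_upwards [(hU i).compl.isOpen.mem_nhds hi] with y' hy'
        simpa [hi] using hy'
    filter_upwards [Filter.eventually_all.2 h] with y' hy'
    have : (fun i : Fin s.length => y' ∈ U i) = fun i : Fin s.length => y ∈ U i :=
      funext fun i => propext (hy' i)
    simpa [this] using hy
  let Q : Set (Fin s.length → Prop) :=
    {q | ∃ z, IsInitial s z ∧ ∀ i : Fin s.length, g z ∈ U i ↔ q i}
  have hQ : {y | s ∈ approxTree U g y} = {y | (fun i : Fin s.length => y ∈ U i) ∈ Q} := by
    ext y
    exact exists_congr fun z => and_congr_right fun _ => ⟨fun h i => h i i.2, fun h i hi => h ⟨i, hi⟩⟩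
  rw [hQ]
  exact ⟨⟨hopen Qᶜ⟩, hopen Q⟩

/-- The chain determines a branch `x`. If `g x ≠ y`, some `U i` contains `y` but not `g x`, and by
continuity `g` avoids `U i` near `x`. A long enough `s` in the chain has a witness `z` near `x` with
`g z ∈ U i`, a contradiction. -/
theorem mem_range_of_infinite_chain [T1Space Y] {U : ℕ → Set Y} (hU : ∀ i, IsClopen (U i))
    (hb : TopologicalSpace.IsTopologicalBasis (Set.range U)) {g : (ℕ → ℕ) → Y} (hg : Continuous g)
    {y : Y} {C : Set (List ℕ)} (hCy : C ⊆ approxTree U g y) (hinf : C.Infinite)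
    (hC : IsChain (· <+: ·) C) : y ∈ Set.range g := by
  obtain ⟨x, hx⟩ := exists_isInitial_of_infinite_chain hinf hC
  refine ⟨x, ?_⟩
  by_contra hne
  obtain ⟨_, ⟨i, rfl⟩, hyi, hsub⟩ := hb.mem_nhds_iff.1
    (isOpen_compl_singleton.mem_nhds (show y ∈ ({g x}ᶜ : Set Y) from fun h => hne h.symm))
  have hxi : x ∈ g ⁻¹' (U i)ᶜ := fun h => hsub h rfl
  obtain ⟨_, ⟨w, n, rfl⟩, hxw, hcyl⟩ :=
    (PiNat.isTopologicalBasis_cylinders (fun _ : ℕ => ℕ)).mem_nhds_iff.1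
      (((hU i).compl.isOpen.preimage hg).mem_nhds hxi)
  obtain ⟨s, hs, hsl⟩ := exists_length_ge_of_infinite_chain hinf hC (max n (i + 1))
  obtain ⟨z, hz, hzU⟩ := hCy hs
  refine hcyl (a := z) (fun j hj => ?_)
    ((hzU i (lt_of_lt_of_le (by simp) ((le_max_right _ _).trans hsl))).2 hyi)
  have hj' : j < s.length := hj.trans_le ((le_max_left _ _).trans hsl)
  rw [← hz j hj', hx s hs j hj']
  exact hxw j hj

theorem exists_continuous_preimage_noInfiniteChain [PolishSpace Y]
    (hY : TopologicalSpace.IsTopologicalBasis {U : Set Y | IsClopen U}) {B : Set Y}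
    (hB : IsCoanalytic B) :
    ∃ f : Y → BinTree → Bool, Continuous f ∧ f ⁻¹' charFunctions noInfiniteChain = B := by
  classical
  rw [IsCoanalytic, MeasureTheory.AnalyticSet] at hB
  rcases hB with hB | ⟨g, hg, hgB⟩
  · refine ⟨fun _ _ => false, continuous_const, ?_⟩
    rw [Set.compl_empty_iff.1 hB]
    refine Set.eq_univ_of_forall fun y => ?_
    simpa [charFunctions] using mem_noInfiniteChain_of_finite Set.finite_empty
  obtain ⟨b, hbs, hbc, hb⟩ := hY.exists_countable
  have hbne : b.Nonempty := by
    obtain ⟨V, hV, -⟩ := hb.mem_nhds_iff.1 (Filter.univ_mem (f := nhds (g 0)))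
    exact ⟨V, hV⟩
  obtain ⟨U, rfl⟩ := hbc.exists_eq_range hbne
  have hU : ∀ i, IsClopen (U i) := fun i => hbs ⟨i, rfl⟩
  refine ⟨fun y t => decide (t ∈ unaryCode '' approxTree U g y), ?_, ?_⟩
  · refine continuous_pi fun t => ?_
    by_cases ht : ∃ s, unaryCode s = t
    · obtain ⟨s, rfl⟩ := ht
      simp only [unaryCode_injective.mem_set_image]
      have h := isClopen_mem_approxTree hU g s
      refine continuous_discrete_rng.2 fun c => ?_
      cases c with
      | true => convert h.isOpen using 1; ext y; simp
      | false => convert h.compl.isOpen using 1; ext y; simp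
    · convert continuous_const (y := false) using 2 with y
      simp only [decide_eq_false_iff_not]
      rintro ⟨s, -, hs⟩
      exact ht ⟨s, hs⟩
  · rw [← compl_inj_iff, ← hgB]
    ext y
    simp only [charFunctions, noInfiniteChain, Set.mem_compl_iff, Set.mem_preimage,
      Set.mem_ofPred_eq, not_not, decide_eq_true_eq]
    constructor
    · rintro ⟨C, hCH, hinf, hC⟩
      have hCi : unaryCode '' (unaryCode ⁻¹' C) = C :=
        Set.image_preimage_eq_of_subset fun t ht => Set.image_subset_range _ _ (hCH ht)
      refine mem_range_of_infinite_chain hU hb hg (C := unaryCode ⁻¹' C) (fun s hs => ?_) ?_ ?_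
      · exact unaryCode_injective.mem_set_image.1 (hCH hs)
      · exact Set.Infinite.of_image unaryCode (by rwa [hCi])
      · intro s hs t ht hst
        exact (hC hs ht (unaryCode_injective.ne hst)).imp unaryCode_prefix_iff.1
          unaryCode_prefix_iff.1
    · rintro ⟨x, rfl⟩
      obtain ⟨C, hCT, hinf, hC⟩ := exists_infinite_chain_approxTree U g x
      refine ⟨unaryCode '' C, Set.image_mono hCT, hinf.image unaryCode_injective.injOn, ?_⟩
      rintro _ ⟨s, hs, rfl⟩ _ ⟨t, ht, rfl⟩ hst
      exact (hC hs ht fun h => hst (h ▸ rfl)).imp unaryCode_prefix_iff.2 unaryCode_prefix_iff.2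

universe u

theorem isPi11Complete_noInfiniteChain :
    IsPi11Complete.{u, 0} (charFunctions noInfiniteChain) :=
  ⟨isCoanalytic_noInfiniteChain, fun _ _ _ hY _ hB =>
    exists_continuous_preimage_noInfiniteChain hY hB⟩

end Hardness

end CombinatorialSpace

namespace CombinatorialSpace

/-! ### Finitely additive measures and a Borel–Cantelli argument. -/

section FinitelyAdditive

open Filter Topology

variable {α : Type*}

/-- Nonnegative, finitely additive set functions defined on all subsets of `α`. -/
structure IsFinitelyAdditive (ν : Set α → ℝ) : Prop where
  nonneg : ∀ S, 0 ≤ ν S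
  union : ∀ S T, Disjoint S T → ν (S ∪ T) = ν S + ν T

namespace IsFinitelyAdditive

variable {ν : Set α → ℝ} (hν : IsFinitelyAdditive ν)

include hν

theorem mono {S T : Set α} (h : S ⊆ T) : ν S ≤ ν T := by
  have h1 := hν.union S (T \ S) Set.disjoint_sdiff_right
  rw [Set.union_sdiff_cancel h] at h1
  linarith [hν.nonneg (T \ S)]

theorem empty : ν ∅ = 0 := by
  have h1 := hν.union ∅ ∅ (by simp)
  rw [Set.union_empty] at h1
  linarith

theorem union_le (S T : Set α) : ν (S ∪ T) ≤ ν S + ν T := by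
  rw [← Set.union_sdiff_self, hν.union _ _ Set.disjoint_sdiff_right]
  linarith [hν.mono (Set.sdiff_subset (s := T) (t := S))]

theorem biUnion_le {ι : Type*} (I : Finset ι) (K : ι → Set α) :
    ν (⋃ i ∈ I, K i) ≤ ∑ i ∈ I, ν (K i) := by
  classical
  induction I using Finset.induction_on with
  | empty => simp [hν.empty]
  | insert i I hi ih =>
    rw [Finset.set_biUnion_insert, Finset.sum_insert hi]
    exact (hν.union_le _ _).trans (by linarith)

/-- Sets of measure bounded below meet infinitely often, in a form that only involves finite unions
and finite intersections. -/
theorem exists_forall_inter_nonempty {K : ℕ → Set α} {ε : ℝ} (hε : 0 < ε)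
    (hK : ∀ n, ε ≤ ν (K n)) :
    ∃ m : ℕ → ℕ, ∀ N, ∃ x, ∀ n ≤ N, ∃ i, n ≤ i ∧ i ≤ m n ∧ x ∈ K i := by
  let V : ℕ → ℕ → Set α := fun n m => {x | ∃ i, n ≤ i ∧ i ≤ m ∧ x ∈ K i}
  have hVmono : ∀ n n' m m', n' ≤ n → m ≤ m' → V n m ⊆ V n' m' :=
    fun n n' m m' hn hm x ⟨i, h1, h2, h3⟩ => ⟨i, hn.trans h1, h2.trans hm, h3⟩
  have hbdd : ∀ n, BddAbove (Set.range fun m => ν (V n m)) := fun n =>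
    ⟨ν Set.univ, by rintro _ ⟨m, rfl⟩; exact hν.mono (Set.subset_univ _)⟩
  -- Without countable additivity the tail unions cannot be measured directly; a finite stage `m n`
  -- nearly attaining the supremum replaces them. The errors `ε / 2 ^ (n + 2)` sum to at most `ε /
  -- 2`.
  have hm : ∀ n, ∃ m, n ≤ m ∧ (⨆ m, ν (V n m)) - ε / 2 ^ (n + 2) < ν (V n m) := fun n => by
    obtain ⟨m, hm⟩ := exists_lt_of_lt_ciSup
      (sub_lt_self (⨆ m, ν (V n m)) (show 0 < ε / 2 ^ (n + 2) by positivity))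
    exact ⟨max n m, le_max_left _ _, hm.trans_le (hν.mono (hVmono _ _ _ _ le_rfl (le_max_right _ _)))⟩
  choose m hnm hm using hm
  refine ⟨m, fun N => ?_⟩
  let D : ℕ → Set α := fun N => {x | ∀ n ≤ N, x ∈ V n (m n)}
  have hdiff : ∀ n, ν (V (n + 1) (m (n + 1)) \ V n (m n)) ≤ ε / 2 ^ (n + 2) := fun n => by
    have h1 := hν.union _ _ (Set.disjoint_sdiff_right (s := V n (m n)) (t := V (n + 1) (m (n + 1))))
    have h2 : V n (m n) ∪ V (n + 1) (m (n + 1)) \ V n (m n) ⊆ V n (max (m n) (m (n + 1))) :=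
      Set.union_subset (hVmono _ _ _ _ le_rfl (le_max_left _ _))
        (Set.sdiff_subset.trans (hVmono _ _ _ _ n.le_succ (le_max_right _ _)))
    have h3 := (hν.mono h2).trans (le_ciSup (hbdd n) _)
    linarith [hm n]
  have hD : ∀ N, ν (V N (m N) \ D N) ≤ ε / 2 * (1 - 1 / 2 ^ N) := by
    intro N
    induction N with
    | zero =>
      have : V 0 (m 0) \ D 0 = ∅ := Set.sdiff_eq_empty.2 fun x hx n hn => by
        rwa [Nat.le_zero.1 hn]
      simp [this, hν.empty]
    | succ N ih =>
      have hsub : V (N + 1) (m (N + 1)) \ D (N + 1) ⊆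
          (V (N + 1) (m (N + 1)) \ V N (m N)) ∪ (V N (m N) \ D N) := by
        rintro x ⟨hx, hxD⟩
        by_cases hxN : x ∈ V N (m N)
        · refine Or.inr ⟨hxN, fun h => hxD fun n hn => ?_⟩
          rcases Nat.le_succ_iff.1 hn with hn | rfl
          · exact h n hn
          · exact hx
        · exact Or.inl ⟨hx, hxN⟩
      refine (hν.mono hsub).trans ((hν.union_le _ _).trans
        ((add_le_add (hdiff N) ih).trans (le_of_eq ?_)))
      field_simp
      ring
  by_contra hne
  have hDN : D N = ∅ := Set.eq_empty_of_forall_notMem fun x hx => hne ⟨x, hx⟩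
  have h1 := hD N
  rw [hDN, Set.sdiff_empty] at h1
  have h2 : ε ≤ ν (V N (m N)) := (hK N).trans (hν.mono fun x hx => ⟨N, le_rfl, hnm N, hx⟩)
  have h3 : (0 : ℝ) < 1 / 2 ^ N := by positivity
  nlinarith

end IsFinitelyAdditive

theorem exists_tendsto_hyperfilter {A : ℕ → Finset α} {w : ℕ → α → ℝ} (hw : ∀ k t, 0 ≤ w k t)
    {M : ℝ} (hM : ∀ k, ∑ t ∈ A k, w k t ≤ M) :
    ∃ ν : Set α → ℝ, IsFinitelyAdditive ν ∧
      (∀ S, Tendsto (fun k => ∑ t ∈ A k, S.indicator (w k) t) (hyperfilter ℕ) (𝓝 (ν S))) := by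
  have h0 : ∀ S : Set α, ∀ k, 0 ≤ ∑ t ∈ A k, S.indicator (w k) t := fun S k =>
    Finset.sum_nonneg fun t _ => Set.indicator_nonneg (fun t _ => hw k t) t
  have h1 : ∀ S : Set α, ∀ k, ∑ t ∈ A k, S.indicator (w k) t ≤ M := fun S k =>
    (Finset.sum_le_sum fun t _ => Set.indicator_le_self' (fun _ _ => hw k _) t).trans (hM k)
  have hlim : ∀ S : Set α, ∃ r,
      Tendsto (fun k => ∑ t ∈ A k, S.indicator (w k) t) (hyperfilter ℕ) (𝓝 r) := fun S => by
    obtain ⟨r, -, hr⟩ := (isCompact_Icc (a := (0 : ℝ)) (b := M)).ultrafilter_le_nhds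
      ((hyperfilter ℕ).map fun k => ∑ t ∈ A k, S.indicator (w k) t)
      (le_principal_iff.2 (Ultrafilter.mem_map.2
        (Eventually.of_forall fun k => ⟨h0 S k, h1 S k⟩)))
    exact ⟨r, hr⟩
  choose ν hν using hlim
  refine ⟨ν, ⟨fun S => ge_of_tendsto' (hν S) (h0 S), fun S T hST => ?_⟩, hν⟩
  refine tendsto_nhds_unique (hν (S ∪ T)) (((hν S).add (hν T)).congr fun k => ?_)
  rw [← Finset.sum_add_distrib]
  refine Finset.sum_congr rfl fun t _ => ?_
  rw [Set.indicator_union_of_disjoint hST]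

end FinitelyAdditive

/-! ### Merging parts of many disjoint antichains into one. -/

section Combinatorics

open Filter Topology

/-- The set of all extensions of elements of `F`. -/
def extensions (F : Finset BinTree) : Set BinTree := {s | ∃ t ∈ F, t <+: s}

theorem isClosed_isInitial (t : BinTree) : IsClosed {b : ℕ → Bool | IsInitial t b} := by
  have : {b : ℕ → Bool | IsInitial t b} = ⋂ i, ⋂ h : i < t.length, {b | t[i] = b i} := by
    ext b
    simp [IsInitial]
  rw [this]
  exact isClosed_iInter fun i => isClosed_iInter fun _ =>
    isClosed_eq continuous_const (continuous_apply i)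

theorem isInitial_getD (s : BinTree) : IsInitial s fun i => s.getD i false := fun i hi => by
  simp [hi]

theorem exists_infinite_chain_of_extensions {A : ℕ → Finset BinTree}
    (hdis : Pairwise fun i j => Disjoint (A i) (A j)) {m : ℕ → ℕ}
    (hm : ∀ N, ∃ s, ∀ n ≤ N, ∃ i, n ≤ i ∧ i ≤ m n ∧ s ∈ extensions (A i)) :
    ∃ C ⊆ ⋃ i, (A i : Set BinTree), C.Infinite ∧ IsChain (· <+: ·) C := by
  -- The bound `m n` does not depend on `N`; thus `Z n` is a finite union of closed sets and
  -- compactness applies to all `n` at once.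
  let Z : ℕ → Set (ℕ → Bool) := fun n =>
    ⋃ i ∈ Set.Icc n (m n), ⋃ t ∈ A i, {b | IsInitial t b}
  have hZ : ∀ n, IsClosed (Z n) := fun n =>
    (Set.finite_Icc _ _).isClosed_biUnion fun i _ =>
      (A i).finite_toSet.isClosed_biUnion fun t _ => isClosed_isInitial t
  have hD : ∀ N, IsClosed (⋂ n ∈ Set.Iic N, Z n) := fun N => isClosed_biInter fun n _ => hZ n
  obtain ⟨b, hb⟩ : (⋂ N, ⋂ n ∈ Set.Iic N, Z n).Nonempty := by
    refine IsCompact.nonempty_iInter_of_sequence_nonempty_isCompact_isClosed _ (fun N => ?_)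
      (fun N => ?_) (hD 0).isCompact hD
    · exact Set.biInter_subset_biInter_left fun n hn => le_trans hn (Nat.le_succ N)
    · obtain ⟨s, hs⟩ := hm N
      refine ⟨fun i => s.getD i false, Set.mem_iInter₂.2 fun n hn => ?_⟩
      obtain ⟨i, h1, h2, t, ht, hts⟩ := hs n hn
      exact Set.mem_biUnion (show i ∈ Set.Icc n (m n) from ⟨h1, h2⟩)
        (Set.mem_biUnion ht ((isInitial_getD s).of_prefix hts))
  have hb' : ∀ n, ∃ i, n ≤ i ∧ ∃ t ∈ A i, IsInitial t b := fun n => by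
    have h := Set.mem_iInter₂.1 (Set.mem_iInter.1 hb n) n Set.self_mem_Iic
    simp only [Z, Set.mem_iUnion, Set.mem_ofPred_eq, exists_prop] at h
    obtain ⟨i, hi, t, ht, htb⟩ := h
    exact ⟨i, hi.1, t, ht, htb⟩
  refine ⟨(⋃ i, (A i : Set BinTree)) ∩ {t | IsInitial t b}, Set.inter_subset_left, fun hfin => ?_,
    (isChain_isInitial b).mono Set.inter_subset_right⟩
  -- By disjointness each node lies in at most one `A i`, so finitely many nodes on `b` would bound
  -- the indices of the antichains that `b` meets.
  have hidx : (⋃ t ∈ (⋃ i, (A i : Set BinTree)) ∩ {t | IsInitial t b}, {i | t ∈ A i}).Finite := by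
    refine hfin.biUnion fun t _ => Set.Subsingleton.finite fun i hi j hj => ?_
    by_contra hij
    exact Finset.disjoint_left.1 (hdis hij) hi hj
  obtain ⟨N, hN⟩ := hidx.bddAbove
  obtain ⟨i, hi, t, ht, htb⟩ := hb' (N + 1)
  have := hN (Set.mem_biUnion ⟨Set.mem_iUnion.2 ⟨i, ht⟩, htb⟩ (show i ∈ {i | t ∈ A i} from ht))
  omega

theorem finite_le_measure_extensions {ν : Set BinTree → ℝ} (hν : IsFinitelyAdditive ν)
    {A : ℕ → Finset BinTree} (hdis : Pairwise fun i j => Disjoint (A i) (A j))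
    (hA : (⋃ i, (A i : Set BinTree)) ∈ noInfiniteChain) {ε : ℝ} (hε : 0 < ε) :
    {n | ε ≤ ν (extensions (A n))}.Finite := by
  by_contra hinf
  let e := Set.Infinite.natEmbedding _ hinf
  have he : ∀ i j, i ≠ j → (e i : ℕ) ≠ e j := fun i j hij h => hij (e.injective (Subtype.ext h))
  obtain ⟨m, hm⟩ := hν.exists_forall_inter_nonempty hε (K := fun n => extensions (A (e n)))
    fun n => (e n).2
  obtain ⟨C, hCA, hC⟩ := exists_infinite_chain_of_extensions (A := fun n => A (e n))
    (fun i j hij => hdis (he i j hij)) hm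
  exact hA ⟨C, hCA.trans (Set.iUnion_subset fun i => Set.subset_iUnion_of_subset (e i : ℕ) le_rfl), hC⟩

theorem exists_antichain_of_weights {A : ℕ → Finset BinTree} (hanti : ∀ k, A k ∈ antichains)
    (hdis : Pairwise fun i j => Disjoint (A i) (A j))
    (hA : (⋃ i, (A i : Set BinTree)) ∈ noInfiniteChain) {w : ℕ → BinTree → ℝ}
    (hw : ∀ k t, 0 ≤ w k t) {δ M : ℝ} (hδ : 0 < δ) (hδw : ∀ k, δ ≤ ∑ t ∈ A k, w k t)
    (hM : ∀ k, ∑ t ∈ A k, w k t ≤ M) (J : ℕ) :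
    ∃ I : Finset ℕ, I.card = J ∧ ∃ B : ℕ → Finset BinTree, (∀ i ∈ I, B i ⊆ A i) ∧
      (∀ i ∈ I, δ / 2 ≤ ∑ t ∈ B i, w i t) ∧ I.biUnion B ∈ antichains := by
  classical
  obtain ⟨ν, hν, hlim⟩ := exists_tendsto_hyperfilter hw hM
  have hε : 0 < δ / (4 * (J + 1)) := by positivity
  have hsmall := finite_le_measure_extensions hν hdis hA hε
  -- The induction also carries smallness of the extensions of each chosen `A i`: up to `J` of them
  -- then have total measure below `δ / 2`, so a new antichain loses less than `δ / 2` of its mass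
  -- above them.
  suffices h : ∀ j ≤ J, ∃ I : Finset ℕ, I.card = j ∧
      (∀ i ∈ I, ν (extensions (A i)) ≤ δ / (4 * (J + 1))) ∧
      ∃ B : ℕ → Finset BinTree, (∀ i ∈ I, B i ⊆ A i) ∧
      (∀ i ∈ I, δ / 2 ≤ ∑ t ∈ B i, w i t) ∧ I.biUnion B ∈ antichains by
    obtain ⟨I, hI, -, hB⟩ := h J le_rfl
    exact ⟨I, hI, hB⟩
  intro j
  induction j with
  | zero => exact fun _ => ⟨∅, rfl, by simp, fun _ => ∅, by simp, by simp, by simp [antichains]⟩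
  | succ j ih =>
    intro hj
    obtain ⟨I, hI, hIν, B, hBA, hBw, hBanti⟩ := ih (by omega)
    let S : Set BinTree := ⋃ i ∈ I, extensions (A i)
    have hS : ν S < δ / 2 := by
      refine (hν.biUnion_le I _).trans_lt ((Finset.sum_le_card_nsmul I _ _ hIν).trans_lt ?_)
      have hj' : (j : ℝ) + 1 ≤ J := by exact_mod_cast hj
      rw [hI, nsmul_eq_mul, mul_div_assoc', div_lt_div_iff₀ (by positivity) two_pos]
      nlinarith
    -- Comparability in the other direction costs no mass: the chosen nodes have finitely many
    -- prefixes, and each prefix lies in at most one `A k`.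
    have hpre : {k | ∃ s ∈ A k, ∃ t ∈ I.biUnion A, s <+: t}.Finite := by
      have hfin : (⋃ t ∈ I.biUnion A, {s : BinTree | s <+: t}).Finite := by
        refine (I.biUnion A).finite_toSet.biUnion fun t _ => ?_
        refine (List.finite_toSet t.inits).subset fun s hs => ?_
        simpa using hs
      refine (hfin.biUnion (t := fun s => {k | s ∈ A k}) fun s _ =>
        Set.Subsingleton.finite fun i hi j hj => ?_).subset ?_
      · by_contra hij
        exact Finset.disjoint_left.1 (hdis hij) hi hj
      · rintro k ⟨s, hs, t, ht, hst⟩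
        exact Set.mem_biUnion (Set.mem_biUnion ht hst) hs
    have hev : ∀ {P : Set ℕ}, P.Finite → ∀ᶠ k in (hyperfilter ℕ : Filter ℕ), k ∉ P :=
      fun hP => hP.compl_mem_hyperfilter
    obtain ⟨k, hkS, hkν, hkpre, hkI⟩ := (((hlim S).eventually (gt_mem_nhds hS)).and
      ((hev hsmall).and ((hev hpre).and (hev I.finite_toSet)))).exists
    have hkI' : k ∉ I := hkI
    have hkν' : ν (extensions (A k)) ≤ δ / (4 * (J + 1)) := (not_le.1 hkν).le
    have hkB : δ / 2 ≤ ∑ t ∈ A k with t ∉ S, w k t := by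
      have h1 := Finset.sum_filter_add_sum_filter_not (A k) (· ∈ S) (w k)
      have h2 : ∑ t ∈ A k, S.indicator (w k) t = ∑ t ∈ A k with t ∈ S, w k t := by
        rw [Finset.sum_filter]
        rfl
      linarith [hδw k]
    have hne : ∀ i ∈ I, i ≠ k := fun i hi h => hkI' (h ▸ hi)
    refine ⟨insert k I, by rw [Finset.card_insert_of_notMem hkI', hI], ?_,
      Function.update B k {t ∈ A k | t ∉ S}, ?_, ?_, ?_⟩
    · simpa [hkν'] using hIν
    · refine Finset.forall_mem_insert _ _ _ |>.2 ⟨by simp, fun i hi => ?_⟩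
      rw [Function.update_of_ne (hne i hi)]
      exact hBA i hi
    · refine Finset.forall_mem_insert _ _ _ |>.2 ⟨by simpa using hkB, fun i hi => ?_⟩
      rw [Function.update_of_ne (hne i hi)]
      exact hBw i hi
    · have hU : (insert k I).biUnion (Function.update B k {t ∈ A k | t ∉ S}) =
          {t ∈ A k | t ∉ S} ∪ I.biUnion B := by
        rw [Finset.biUnion_insert, Function.update_self]
        congr 1
        exact Finset.biUnion_congr rfl fun i hi => Function.update_of_ne (hne i hi) _ _
      have hold : ∀ t ∈ I.biUnion B, ∃ i ∈ I, t ∈ A i := fun t ht => by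
        obtain ⟨i, hi, hti⟩ := Finset.mem_biUnion.1 ht
        exact ⟨i, hi, hBA i hi hti⟩
      rw [hU]
      change IsAntichain _ _
      rw [Finset.coe_union, isAntichain_union]
      refine ⟨(hanti k).subset (Finset.coe_subset.2 (Finset.filter_subset _ _)), hBanti, fun s hs t ht _ => ?_⟩
      obtain ⟨hsA, hsS⟩ := Finset.mem_filter.1 (Finset.mem_coe.1 hs)
      obtain ⟨i, hi, hti⟩ := hold t ht
      refine ⟨fun hst => hkpre ⟨s, hsA, t, Finset.mem_biUnion.2 ⟨i, hi, hti⟩, hst⟩, fun hts => ?_⟩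
      exact hsS (Set.mem_biUnion hi ⟨t, hti, hts⟩)

end Combinatorics

end CombinatorialSpace

namespace CombinatorialSpace

/-! ### Without infinite chains there is no copy of `c₀`. -/

section NoC0

open Filter Topology

/-- The signs are chosen one at a time. Averaging over both signs of the new term `a`, the mean of
`|a + b|` and `|-a + b|` dominates `|a|`, used on the new block, and `|b|`, used on the old ones;
one of the two signs does at least as well as the mean. -/
theorem exists_signs {Ω : Type*} [DecidableEq Ω] (y : ℕ → Ω → ℝ) (B : ℕ → Finset Ω)
    (I : Finset ℕ) (hB : (I : Set ℕ).PairwiseDisjoint B) :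
    ∃ σ : ℕ → ℝ, (∀ i, |σ i| ≤ 1) ∧
      ∑ i ∈ I, ∑ t ∈ B i, |y i t| ≤ ∑ t ∈ I.biUnion B, |∑ i ∈ I, σ i * y i t| := by
  induction I using Finset.induction_on with
  | empty => exact ⟨0, by simp, by simp⟩
  | insert k I hk ih =>
    obtain ⟨σ, hσ, h⟩ := ih (hB.subset (by simp))
    have hdis : Disjoint (B k) (I.biUnion B) :=
      (Finset.disjoint_biUnion_right _ _ _).2 fun i hi =>
        hB (by simp) (by simp [hi]) fun h => hk (h ▸ hi)
    have hsum : ∀ r t, ∑ i ∈ insert k I, Function.update σ k r i * y i t =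
        r * y k t + ∑ i ∈ I, σ i * y i t := fun r t => by
      rw [Finset.sum_insert hk, Function.update_self]
      congr 1
      exact Finset.sum_congr rfl fun i hi => by
        rw [Function.update_of_ne (ne_of_mem_of_not_mem hi hk)]
    have hbd : ∀ r, |r| ≤ 1 → ∀ i, |Function.update σ k r i| ≤ 1 := fun r hr i => by
      by_cases hik : i = k
      · subst hik
        simpa using hr
      · simpa [hik] using hσ i
    have hmax : ∀ a b : ℝ, 2 * |a| ≤ |1 * a + b| + |-1 * a + b| ∧
        2 * |b| ≤ |1 * a + b| + |-1 * a + b| := fun a b => by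
      constructor
      · have := abs_sub (1 * a + b) (-1 * a + b)
        rw [show 1 * a + b - (-1 * a + b) = 2 * a by ring, abs_mul, abs_two] at this
        exact this
      · have := abs_add_le (1 * a + b) (-1 * a + b)
        rw [show 1 * a + b + (-1 * a + b) = 2 * b by ring, abs_mul, abs_two] at this
        exact this
    have htwo : 2 * ∑ i ∈ insert k I, ∑ t ∈ B i, |y i t| ≤
        ∑ t ∈ (insert k I).biUnion B, |∑ i ∈ insert k I, Function.update σ k 1 i * y i t| +
        ∑ t ∈ (insert k I).biUnion B, |∑ i ∈ insert k I, Function.update σ k (-1) i * y i t| := by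
      simp only [hsum]
      rw [← Finset.sum_add_distrib, Finset.biUnion_insert, Finset.sum_union hdis,
        Finset.sum_insert hk, mul_add]
      refine add_le_add ?_ ((mul_le_mul_of_nonneg_left h zero_le_two).trans ?_)
      · rw [Finset.mul_sum]
        exact Finset.sum_le_sum fun t _ => (hmax _ _).1
      · rw [Finset.mul_sum]
        exact Finset.sum_le_sum fun t _ => (hmax _ _).2
    by_cases h1 : ∑ i ∈ insert k I, ∑ t ∈ B i, |y i t| ≤
        ∑ t ∈ (insert k I).biUnion B, |∑ i ∈ insert k I, Function.update σ k 1 i * y i t|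
    · exact ⟨_, hbd 1 (by simp), h1⟩
    · exact ⟨_, hbd (-1) (by simp), by linarith⟩

/-- The unit vectors of `c₀`. -/
def unitC0 (n : ℕ) : C₀(ℕ, ℝ) where
  toFun := Pi.single n 1
  continuous_toFun := continuous_of_discreteTopology
  zero_at_infty' := by
    rw [cocompact_eq_cofinite]
    refine tendsto_const_nhds.congr' ?_
    filter_upwards [(Set.finite_singleton n).compl_mem_cofinite] with m hm
    exact (Pi.single_eq_of_ne (M := fun _ => ℝ) hm _).symm

theorem unitC0_apply (n m : ℕ) : unitC0 n m = if m = n then 1 else 0 :=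
  Pi.single_apply n (1 : ℝ) m

theorem norm_unitC0 (n : ℕ) : 1 ≤ ‖unitC0 n‖ := by
  simpa [unitC0_apply] using abs_apply_le_norm (unitC0 n) n

theorem sum_C0_apply (I : Finset ℕ) (a : ℕ → C₀(ℕ, ℝ)) (m : ℕ) :
    (∑ i ∈ I, a i) m = ∑ i ∈ I, a i m := by
  classical
  induction I using Finset.induction_on with
  | empty => simp
  | insert k I hk ih => simp [Finset.sum_insert hk, ih]

theorem norm_sum_unitC0_le {n : ℕ → ℕ} (hn : Function.Injective n) {σ : ℕ → ℝ}
    (hσ : ∀ i, |σ i| ≤ 1) (I : Finset ℕ) : ‖∑ i ∈ I, σ i • unitC0 (n i)‖ ≤ 1 := by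
  refine norm_le_of_forall_abs_le zero_le_one fun m => ?_
  rw [sum_C0_apply]
  by_cases h : ∃ i ∈ I, n i = m
  · obtain ⟨i, hi, rfl⟩ := h
    rw [Finset.sum_eq_single_of_mem i hi fun j _ hj => by
      simp [unitC0_apply, hn.ne hj.symm]]
    simpa [unitC0_apply] using hσ i
  · rw [Finset.sum_eq_zero fun i hi => by
      simp [unitC0_apply, show m ≠ n i from fun hm => h ⟨i, hi, hm.symm⟩]]
    simp

/-- Functionals on `c₀` are summable: testing `φ` on sums of signed unit vectors, of norm at most
`1`, bounds the partial sums by `‖φ‖`. -/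
theorem tendsto_functional_unitC0 (φ : C₀(ℕ, ℝ) →L[ℝ] ℝ) :
    Tendsto (fun n => |φ (unitC0 n)|) atTop (𝓝 0) := by
  refine (summable_of_sum_range_le (c := ‖φ‖) (fun _ => abs_nonneg _) fun N => ?_).tendsto_atTop_zero
  have hσ : ∀ i, |((SignType.sign (φ (unitC0 i)) : SignType) : ℝ)| ≤ 1 := fun i => by
    cases SignType.sign (φ (unitC0 i)) <;> simp
  have h := φ.le_of_opNorm_le_of_le le_rfl
    (norm_sum_unitC0_le Function.injective_id hσ (Finset.range N))
  rw [map_sum, mul_one] at h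
  refine le_trans (le_of_eq ?_) ((le_abs_self _).trans h)
  exact Finset.sum_congr rfl fun i _ => by simp [sign_mul_self]

theorem not_containsC0_of_noInfiniteChain {H : Set BinTree} (hH : H ∈ noInfiniteChain) :
    ¬ ContainsC0 (spaceOn antichains H) := by
  classical
  rintro ⟨T, c, hc, hT⟩
  let y : ℕ → BinTree → ℝ := fun n => Space.coord (T (unitC0 n) : Space antichains)
  have hyH : ∀ n t, t ∉ H → y n t = 0 := fun n t ht =>
    coord_eq_zero_of_mem_spaceOn (T (unitC0 n)).2 ht
  have hylim : ∀ t, Tendsto (fun n => |y n t|) atTop (𝓝 0) := fun t =>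
    tendsto_functional_unitC0 (((coordCLM t).comp (spaceOn antichains H).subtypeL).comp T)
  have hylow : ∀ n, c ≤ ‖T (unitC0 n)‖ := fun n =>
    (le_mul_of_one_le_right hc.le (norm_unitC0 n)).trans (hT _)
  have hyup : ∀ n, ‖T (unitC0 n)‖ ≤ ‖T‖ := fun n => by
    have h := norm_sum_unitC0_le Function.injective_id (σ := fun _ => 1) (by simp) {n}
    simp only [Finset.sum_singleton, one_smul, id] at h
    simpa using T.le_of_opNorm_le_of_le le_rfl h
  obtain ⟨f, hf, hfr⟩ := exists_seq_of_forall_finset_exists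
    (fun p : ℕ × Finset BinTree =>
      p.2 ∈ antichains ∧ (p.2 : Set BinTree) ⊆ H ∧ c / 2 ≤ ∑ t ∈ p.2, |y p.1 t|)
    (fun p q => p.1 ≠ q.1 ∧ Disjoint p.2 q.2) (fun s _ => by
      -- `E` collects the antichains already used. For large `n` the mass on `E` is below `c / 4`,
      -- while some antichain carries more than `3 * c / 4`; at least `c / 2` remains off `E`, all
      -- of it inside `H`.
      let E := s.biUnion Prod.snd
      have hE : Tendsto (fun n => ∑ t ∈ E, |y n t|) atTop (𝓝 0) := by
        simpa using tendsto_finsetSum E fun t _ => hylim t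
      have hs : ∀ᶠ n in atTop, n ∉ ((s.image Prod.fst : Finset ℕ) : Set ℕ) := by
        rw [← Nat.cofinite_eq_atTop]
        exact (s.image Prod.fst).finite_toSet.compl_mem_cofinite
      obtain ⟨n, hnE, hns⟩ :=
        ((hE.eventually (gt_mem_nhds (show 0 < c / 4 by linarith))).and hs).exists
      obtain ⟨F, hF, hFn⟩ := exists_lt_sum_abs_coord (𝓕 := antichains) (r := 3 * c / 4)
        (x := (T (unitC0 n) : Space antichains)) (by linarith)
        (lt_of_lt_of_le (by linarith) (hylow n))
      refine ⟨(n, {t ∈ F \ E | t ∈ H}), ⟨?_, fun t ht => ?_, ?_⟩, fun p hp => ⟨?_, ?_⟩⟩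
      · exact IsAntichain.subset hF fun t ht => by
          simp only [Finset.coe_filter, Finset.mem_sdiff, Set.mem_ofPred_eq] at ht
          exact ht.1.1
      · exact (Finset.mem_filter.1 (Finset.mem_coe.1 ht)).2
      · have h1 : ∑ t ∈ F \ E with t ∈ H, |y n t| = ∑ t ∈ F \ E, |y n t| :=
          Finset.sum_filter_of_ne fun t _ ht => by
            by_contra hH
            simp [hyH n t hH] at ht
        have h2 : ∑ t ∈ F, |y n t| ≤ ∑ t ∈ F \ E, |y n t| + ∑ t ∈ E, |y n t| := by
          rw [← Finset.sum_union Finset.sdiff_disjoint]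
          exact Finset.sum_le_sum_of_subset_of_nonneg (by simp) fun _ _ _ => abs_nonneg _
        change c / 2 ≤ ∑ t ∈ F \ E with t ∈ H, |y n t|
        rw [h1]
        change 3 * c / 4 < ∑ t ∈ F, |y n t| at hFn
        linarith
      · intro h
        exact hns (Finset.mem_coe.2 (Finset.mem_image.2 ⟨p, hp, h⟩))
      · refine Finset.disjoint_left.2 fun t htp ht => ?_
        exact (Finset.mem_sdiff.1 (Finset.mem_filter.1 ht).1).2 (Finset.mem_biUnion.2 ⟨p, hp, htp⟩))
  have hninj : Function.Injective fun k => (f k).1 := fun i j hij => by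
    rcases lt_trichotomy i j with h | h | h
    · exact absurd hij (hfr i j h).1
    · exact h
    · exact absurd hij.symm (hfr j i h).1
  have hdis : Pairwise fun i j => Disjoint (f i).2 (f j).2 := fun i j hij => by
    rcases lt_or_gt_of_ne hij with h | h
    · exact (hfr i j h).2
    · exact (hfr j i h).2.symm
  have hchain : (⋃ i, ((f i).2 : Set BinTree)) ∈ noInfiniteChain :=
    isIdealOfSets_noInfiniteChain.2.2.1 _ H (Set.iUnion_subset fun i => (hf i).2.1) hH
  -- Each selected block retains half of `c / 2`, so `J` blocks contribute at least `J * (c / 4)`,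
  -- which exceeds `‖T‖`.
  obtain ⟨J, hJ⟩ := exists_nat_gt (‖T‖ / (c / 4))
  rw [div_lt_iff₀ (by positivity)] at hJ
  obtain ⟨I, hI, B, hBA, hBw, hBanti⟩ := exists_antichain_of_weights (fun k => (hf k).1) hdis hchain
    (w := fun k t => |y (f k).1 t|) (fun _ _ => abs_nonneg _) (half_pos hc) (fun k => (hf k).2.2)
    (fun k => (sum_abs_coord_le_norm (T (unitC0 (f k).1) : Space antichains) (hf k).1).trans
      (hyup _)) J
  obtain ⟨σ, hσ, hσB⟩ := exists_signs (fun k => y (f k).1) B I fun i hi j hj hij =>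
    (hdis hij).mono (hBA i hi) (hBA j hj)
  have h1 : J * (c / 4) ≤ ∑ i ∈ I, ∑ t ∈ B i, |y (f i).1 t| := by
    rw [← hI, ← nsmul_eq_mul]
    exact Finset.card_nsmul_le_sum _ _ _ fun i hi => by linarith [hBw i hi]
  have h2 := sum_abs_coord_le_norm
    (T (∑ i ∈ I, σ i • unitC0 (f i).1) : Space antichains) hBanti
  have h3 : ∀ t, Space.coord (T (∑ i ∈ I, σ i • unitC0 (f i).1) : Space antichains) t =
      ∑ i ∈ I, σ i * y (f i).1 t := fun t => by
    simp [y, Finset.sum_apply]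
  have h4 := T.le_of_opNorm_le_of_le le_rfl (norm_sum_unitC0_le hninj hσ I)
  simp only [h3] at h2
  rw [mul_one] at h4
  have h5 := h2.trans h4
  linarith

theorem idealNoC0_antichains : idealNoC0 antichains = noInfiniteChain := by
  refine Set.Subset.antisymm ?_ fun H hH => not_containsC0_of_noInfiniteChain hH
  rintro H hH ⟨C, hCH, hinf, hC⟩
  exact hH (containsC0_of_infinite_chain hCH hinf hC)

end NoC0

end CombinatorialSpace

universe u

open CombinatorialSpace in
theorem mainTheorem5 :
    idealNoC0 antichains =
        {H : Set BinTree | ¬ ∃ C : Set BinTree, C ⊆ H ∧ C.Infinite ∧ IsChain (· <+: ·) C} ∧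
      IsIdealOfSets (idealNoC0 antichains) ∧
      IsPi11Complete.{u, 0} (charFunctions (idealNoC0 antichains)) := by
  refine ⟨idealNoC0_antichains, ?_, ?_⟩ <;> rw [idealNoC0_antichains]
  · exact isIdealOfSets_noInfiniteChain
  · exact isPi11Complete_noInfiniteChain
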